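/- **Setting.** Let $F:[0,\infty)\to[0,\infty)$ be continuous, strictly increasing and piecewise smooth, with $F(0)=0$, $F(1)=2$, $F(2)=3$, $F(x)\to\infty$ as $x\to\infty$, with (weakly) decreasing right derivative $F'$, and with $F'(x)\le \frac{2}{8x+1}$ for $x\ge 2$. For a finite graph $A$ (simple, undirected) with edge set $E_A$ put $\delta(A)=2|A|-|E_A|$. "Subgraph" means induced subgraph. Let $\mathcal C_F$ be the class of finite graphs $B$ such that $\delta(A)>0$ for every nonempty $A\subseteq B$ and $\delta(A)\ge F(|A|)$ for every $A\subseteq B$. For finite graphs $A\subseteq B$ write $A\le_d B$ if $\delta(A)<\delta(C)$ whenever $A\subsetneq C\subseteq B$; for a finite subgraph $A$ of an infinite graph $M$ write $A\le_d M$ if $A\le_d X$ for every finite $X$ with $A\subseteq X\subseteq M$. Let $M=M_F$ be the Fraïssé limit of $(\mathcal C_F,\le_d)$: the union of an increasing $\le_d$-chain of graphs in $\mathcal C_F$, such that every $A\in\mathcal C_F$ is isomorphic to some $A'\le_d M$, and every isomorphism between finite subgraphs $A,A'\le_d M$ extends to an automorphism of $M$. A *2-orientation* of $M$ is a set $\tau\subseteq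 M^2$ of ordered pairs of adjacent vertices which contains exactly one of $(x,y),(y,x)$ for each edge $xy$ of $M$, and in which every vertex has at most two out-edges: $|\{y:(x,y)\in\tau\}|\le 2$ for all $x\in M$. Let $\mathrm{Or}(M)\subseteq 2^{M^2}$ be the set of 2-orientations, where subsets of $M^2$ are identified with their characteristic functions, $2^{M^2}$ has the product topology, and $\mathrm{Aut}(M)$ acts on it by $g\cdot\rho=\{(gx,gy):(x,y)\in\rho\}$. Let $S_1(M)$ be the Stone space of complete $1$-types over $M$ in the language of graphs, with the action $g\cdot p(x)=\{\varphi(x,g\bar m):\varphi(x,\bar m)\in p(x)\}$ of $\mathrm{Aut}(M)$. A *subflow* is a nonempty compact $\mathrm{Aut}(M)$-invariant subset. For $a,b\in M$ let $f(x,a,b)$ be the formula saying that $x\ne a$, $x\ne b$, $a\ne b$, $a\sim b$, and that there are pairwise distinct $l_1,l_2,l_3,l_4$, all different from $x,a,b$, with $$x\sim l_1,\quad l_1\sim l_2,\quad l_2\sim l_3,\quad l_3\sim l_4,\quad l_4\sim l_1,\quad l_2\sim a,\quad l_4\sim a,\quad l_3\sim b.$$ A type $p(x)\in S_1(M)$ *encodes*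 $\tau$ if $f(x,a,b)\in p$ for all $(a,b)\in\tau$ and $\neg f(x,a,b)\in p$ for all $(a,b)\in M^2\setminus\tau$. The *decoding map* $u:S_1(M)\to 2^{M^2}$ is $u(p)=\{(a,b)\in M^2: f(x,a,b)\in p\}$. **Lemma 5.3 (encoding lemma).** For every 2-orientation $\tau\in\mathrm{Or}(M)$ there is a type $p(x)\in S_1(M)$ that encodes $\tau$. Moreover $u$ is continuous and $\mathrm{Aut}(M)$-equivariant, and $\mathrm{Or}(M)$ is a subflow of the image of $u$; that is, $\mathrm{Or}(M)$ and $u(S_1(M))$ are subflows of $2^{M^2}$ and $\mathrm{Or}(M)\subseteq u(S_1(M))$. -/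

import Mathlib

open FirstOrder Filter
open scoped ContDiff

namespace Encoding

/-! ### Predimension and `d`-closed sets

Finite graphs are handled as induced subgraphs `G[S]` of a graph `G` on a finite vertex set `S`. -/

section Predimension

variable {V : Type*} (G : SimpleGraph V)

open Classical in
/-- The edges of the induced subgraph `G[S]`. -/
noncomputable def edgesIn (S : Finset V) : Finset (Sym2 V) :=
  S.sym2.filter (fun e => e ∈ G.edgeSet)

/-- The predimension `δ(S) = 2|S| - |E_S|` of the induced subgraph on `S`. -/
noncomputable def predim (S : Finset V) : ℤ :=
  2 * (S.card : ℤ) - ((edgesIn G S).card : ℤ)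

/-- The finite graph `G[S]` lies in the class `C_{>0}`. -/
def InCpos (S : Finset V) : Prop :=
  ∀ B : Finset V, B ⊆ S → B.Nonempty → 0 < predim G B

/-- The finite graph `G[S]` lies in the class `C_F`. -/
def InCF (F : ℝ → ℝ) (S : Finset V) : Prop :=
  InCpos G S ∧ ∀ A : Finset V, A ⊆ S → F (A.card : ℝ) ≤ (predim G A : ℝ)

/-- `A ≤_d B` for finite vertex sets `A ⊆ B`. -/
def DClosed (A B : Finset V) : Prop :=
  A ⊆ B ∧ ∀ C : Finset V, A ⊂ C → C ⊆ B → predim G A < predim G C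

/-- `A ≤_d G` for a finite vertex set `A` of a possibly infinite graph `G`: the set `A` is
`d`-closed in every finite set of vertices that contains it. -/
def DClosedIn (A : Finset V) : Prop :=
  ∀ X : Finset V, A ⊆ X → DClosed G A X

end Predimension

/-! ### Control functions -/

/-- Control functions. Only the values of `F` on `[0, ∞)` matter. -/
structure IsControl (F : ℝ → ℝ) : Prop where
  continuousOn : ContinuousOn F (Set.Ici 0)
  strictMonoOn : StrictMonoOn F (Set.Ici 0)
  map_zero : F 0 = 0
  tendsto_atTop : Tendsto F atTop atTop

/-- `F` is piecewise smooth on `[0, ∞)`: it is smooth off a set of breakpoints that is finite in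
every bounded interval. (One-sided derivatives at the breakpoints are required where they are
needed, in `IsEncodingControl`.) -/
def PiecewiseSmooth (F : ℝ → ℝ) : Prop :=
  ∃ S : Set ℝ, (∀ R : ℝ, (S ∩ Set.Icc 0 R).Finite) ∧
    ∀ x : ℝ, 0 < x → x ∉ S → ContDiffAt ℝ ∞ F x

/-- The right derivative of `F` at `x`. -/
noncomputable def rightDeriv (F : ℝ → ℝ) (x : ℝ) : ℝ :=
  derivWithin F (Set.Ioi x) x

/-- The control functions used for the encoding structure. -/
structure IsEncodingControl (F : ℝ → ℝ) : Prop extends IsControl F where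
  piecewiseSmooth : PiecewiseSmooth F
  differentiable_right : ∀ x : ℝ, 0 < x → DifferentiableWithinAt ℝ F (Set.Ioi x) x
  rightDeriv_antitone : AntitoneOn (rightDeriv F) (Set.Ioi 0)
  map_one : F 1 = 2
  map_two : F 2 = 3
  rightDeriv_le : ∀ x : ℝ, 2 ≤ x → rightDeriv F x ≤ 2 / (8 * x + 1)

/-! ### The Fraïssé limit -/

/-- `G` is the Fraïssé limit `M_F` of `(C_F, ≤_d)`: the union of an increasing `≤_d`-chain in
`C_F`, whose `≤_d`-age is `C_F`, and which is `≤_d`-ultrahomogeneous. -/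
structure IsFraisseLimit (F : ℝ → ℝ) {V : Type*} (G : SimpleGraph V) : Prop where
  /-- `G` is the union of a `≤_d`-chain of finite graphs in `C_F`. -/
  chain : ∃ A : ℕ → Finset V, (∀ i, InCF G F (A i)) ∧ (∀ i, DClosed G (A i) (A (i + 1))) ∧
    ∀ v : V, ∃ i, v ∈ A i
  /-- Every finite graph in `C_F` (up to isomorphism, a graph on some `Fin n`) has a
  `≤_d`-embedding into `G`. -/
  age : ∀ (n : ℕ) (H : SimpleGraph (Fin n)), InCF H F Finset.univ →
    ∃ e : H ↪g G, DClosedIn G (Finset.univ.map e.toEmbedding)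
  /-- Every isomorphism between finite `d`-closed subgraphs extends to an automorphism. -/
  ultrahomogeneous : ∀ A B : Finset V, DClosedIn G A → DClosedIn G B →
    ∀ f : G.induce (A : Set V) ≃g G.induce (B : Set V),
      ∃ g : G ≃g G, ∀ v : (A : Set V), g (v : V) = (f v : V)

/-! ### The flow of sets of pairs, and the 2-orientations -/

section Orientations

variable {V : Type*} (G : SimpleGraph V)

/-- `ρ` is a 2-orientation of `G`. -/
structure IsTwoOrientation (ρ : Set (V × V)) : Prop where
  adj : ∀ x y : V, (x, y) ∈ ρ → G.Adj x y
  exactly_one : ∀ x y : V, G.Adj x y → Xor ((x, y) ∈ ρ) ((y, x) ∈ ρ)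
  outDegree_le : ∀ x : V, {y : V | (x, y) ∈ ρ}.encard ≤ 2

/-- The space `Or(M)` of 2-orientations, as a set of points of the Cantor space `2^{M²}`. A subset
of `M²` is identified with its characteristic function. -/
def orientations : Set (V × V → Bool) :=
  {χ | IsTwoOrientation G {ab : V × V | χ ab = true}}

/-- The natural action of `Aut(M)` on `2^{M²}`: `g · ρ = {(g x, g y) : (x, y) ∈ ρ}`. -/
instance pairAction : MulAction (G ≃g G) (V × V → Bool) where
  smul g χ := fun ab => χ (g⁻¹ ab.1, g⁻¹ ab.2)
  one_smul χ := rfl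
  mul_smul g h χ := by
    funext ab
    change χ ((g * h)⁻¹ ab.1, (g * h)⁻¹ ab.2) = χ (h⁻¹ (g⁻¹ ab.1), h⁻¹ (g⁻¹ ab.2))
    rw [mul_inv_rev]
    rfl

end Orientations

/-- `Y` is a subflow of `X`: a nonempty compact invariant set. -/
structure IsSubflow (Γ : Type*) {X : Type*} [Group Γ] [TopologicalSpace X] [MulAction Γ X]
    (Y : Set X) : Prop where
  nonempty : Y.Nonempty
  isCompact : IsCompact Y
  smul_mem : ∀ (g : Γ) (y : X), y ∈ Y → g • y ∈ Y

/-! ### The type space `S_1(M)` -/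

section Types

variable {V : Type*} (G : SimpleGraph V)

/-- The language of graphs with a constant for every element of `M`. -/
abbrev LM (V : Type*) : Language := Language.graph[[V]]

/-- The elementary diagram of `M`: the complete theory of `M` with all its elements named. -/
abbrev diagram : (LM V).Theory :=
  letI := G.structure
  Language.graph.elementaryDiagram V

/-- `S_1(M)`: complete 1-types over `M`, with the Stone topology. -/
abbrev TypeSpace : Type _ :=
  (diagram G).CompleteType (Fin 1)

/-- The formula `φ(x)` with parameters in `M` belongs to the type `p(x)`. -/
def Contains {G : SimpleGraph V} (p : TypeSpace G) (φ : (LM V).Formula (Fin 1)) : Prop :=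
  Language.Formula.equivSentence φ ∈ p

/-- The translation `φ(x, m) ↦ φ(x, g m)` of parameters. -/
def translate (g : V → V) : (LM V)[[Fin 1]] →ᴸ (LM V)[[Fin 1]] :=
  (Language.graph.lhomWithConstantsMap g).addConstants (Fin 1)

theorem translate_onSentence_id (ψ : (LM V)[[Fin 1]].Sentence) :
    (translate (id : V → V)).onSentence ψ = ψ := by
  have h : translate (id : V → V) = Language.LHom.id _ := by
    refine Language.LHom.funext ?_ ?_
    · funext n f
      rcases f with (f | f) | f
      · rfl
      · cases n
        · rfl
        · exact isEmptyElim f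
      · rfl
    · funext n R
      rcases R with (R | R) | R
      · rfl
      · exact isEmptyElim R
      · rfl
  rw [h]
  exact congrFun (Language.LHom.id_onBoundedFormula) ψ

theorem translate_onSentence_comp (g h : V → V) (ψ : (LM V)[[Fin 1]].Sentence) :
    (translate g).onSentence ((translate h).onSentence ψ) = (translate (g ∘ h)).onSentence ψ := by
  have e : translate (g ∘ h) = (translate g).comp (translate h) := by
    refine Language.LHom.funext ?_ ?_
    · funext n f
      rcases f with (f | f) | f
      · rfl
      · cases n
        · rfl
        · exact isEmptyElim f
      · rfl
    · funext n R
      rcases R with (R | R) | R <;> rfl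
  rw [e]
  exact (congrFun (Language.LHom.comp_onBoundedFormula (translate g) (translate h)) ψ).symm

theorem translate_lhomWithConstants (g : V → V) (ψ : (LM V).Sentence) :
    ((LM V).lhomWithConstants (Fin 1)).onSentence
        ((Language.graph.lhomWithConstantsMap g).onSentence ψ) =
      (translate g).onSentence (((LM V).lhomWithConstants (Fin 1)).onSentence ψ) := by
  have e : ((LM V).lhomWithConstants (Fin 1)).comp (Language.graph.lhomWithConstantsMap g) =
      (translate g).comp ((LM V).lhomWithConstants (Fin 1)) := rfl
  have h₁ := congrFun (Language.LHom.comp_onBoundedFormula (α := Empty) (n := 0)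
    ((LM V).lhomWithConstants (Fin 1)) (Language.graph.lhomWithConstantsMap g)) ψ
  have h₂ := congrFun (Language.LHom.comp_onBoundedFormula (α := Empty) (n := 0)
    (translate g) ((LM V).lhomWithConstants (Fin 1))) ψ
  rw [e] at h₁
  exact h₁.symm.trans h₂

/-- Automorphisms preserve truth of formulas with parameters. -/
theorem translate_diagram (g : G ≃g G) (ψ : (LM V).Sentence) (hψ : ψ ∈ diagram G) :
    (Language.graph.lhomWithConstantsMap g).onSentence ψ ∈ diagram G := by
  let := G.structure
  have hψ' : V ⊨ ψ := hψ
  change V ⊨ (Language.graph.lhomWithConstantsMap g).onSentence ψ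
  let S₀ : (LM V).Structure V := Language.graph.withConstantsSelfStructure
  let S : (LM V).Structure V := (Language.graph.lhomWithConstantsMap (g : V → V)).reduct V
  have hS : @Language.LHom.IsExpansionOn (LM V) (LM V)
      (Language.graph.lhomWithConstantsMap (g : V → V)) V S S₀ :=
    @Language.LHom.IsExpansionOn.mk _ _ _ _ S S₀ (fun _ _ => rfl) (fun _ _ => rfl)
  refine (@Language.LHom.realize_onSentence (LM V) (LM V) V S S₀ _ hS ψ).2 ?_
  let e : @Language.Equiv (LM V) V V S₀ S :=
    @Language.Equiv.mk (LM V) V V S₀ S g.toEquiv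
      (by
        intro n f x
        rcases f with f | f
        · exact isEmptyElim f
        · cases n
          · rfl
          · exact isEmptyElim f)
      (by
        intro n R x
        rcases R with R | R
        · cases R
          exact g.map_rel_iff
        · exact isEmptyElim R)
  exact (@Language.StrongHomClass.realize_sentence (LM V) V V S₀ S _ _ _ e ψ).1 hψ'

/-- The natural action of `Aut(M)` on `S_1(M)`: `g · p(x) = {φ(x, g m) : φ(x, m) ∈ p(x)}`. -/
instance typeAction : MulAction (G ≃g G) (TypeSpace G) where
  smul g p :=
    { toTheory := {ψ | (translate (g⁻¹ : G ≃g G)).onSentence ψ ∈ p}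
      subset' := by
        rintro _ ⟨ψ, hψ, rfl⟩
        refine p.subset ⟨_, translate_diagram G g⁻¹ ψ hψ, ?_⟩
        exact translate_lhomWithConstants _ ψ
      isMaximal' := by
        refine ⟨?_, fun ψ => p.mem_or_not_mem ((translate (g⁻¹ : G ≃g G)).onSentence ψ)⟩
        refine Language.Theory.isSatisfiable_of_isSatisfiable_onTheory
          (translate (g⁻¹ : G ≃g G)) (p.isMaximal.1.mono ?_)
        rintro _ ⟨ψ, hψ, rfl⟩
        exact hψ }
  one_smul p := by
    refine SetLike.ext fun ψ => ?_
    change (translate ((1 : G ≃g G)⁻¹ : G ≃g G)).onSentence ψ ∈ p ↔ ψ ∈ p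
    rw [inv_one]
    exact iff_of_eq (congrArg (· ∈ p) (translate_onSentence_id ψ))
  mul_smul g h p := by
    refine SetLike.ext fun ψ => ?_
    change (translate ((g * h)⁻¹ : G ≃g G)).onSentence ψ ∈ p ↔
      (translate (h⁻¹ : G ≃g G)).onSentence ((translate (g⁻¹ : G ≃g G)).onSentence ψ) ∈ p
    rw [translate_onSentence_comp, mul_inv_rev]
    rfl

/-- The adjacency symbol, in the language with parameters. -/
abbrev adjSymbol : (LM V).Relations 2 :=
  (Language.graph.lhomWithConstants V).onRelation Language.adj

/-- The free variable `x`. -/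
abbrev varX : (LM V).Term (Fin 1 ⊕ Fin 4) :=
  Language.Term.var (Sum.inl 0)

/-- The bound variable `l_{i+1}`. -/
abbrev varL (i : Fin 4) : (LM V).Term (Fin 1 ⊕ Fin 4) :=
  Language.Term.var (Sum.inr i)

/-- The parameter `a`. -/
abbrev param {β : Type} (a : V) : (LM V).Term β :=
  (Language.graph.con a).term

/-- Adjacency `s ∼ t` as a formula. -/
abbrev adjF {n : ℕ} (s t : (LM V).Term (Fin 1 ⊕ Fin n)) : (LM V).BoundedFormula (Fin 1) n :=
  adjSymbol.boundedFormula₂ s t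

/-- Distinctness `s ≠ t` as a formula. -/
abbrev neF {n : ℕ} (s t : (LM V).Term (Fin 1 ⊕ Fin n)) : (LM V).BoundedFormula (Fin 1) n :=
  ∼(s =' t)

/-- The quantifier-free part of the label formula that mentions `l_1, l_2, l_3, l_4`. -/
def labelBody (a b : V) : (LM V).BoundedFormula (Fin 1) 4 :=
  (neF (varL 0) (varL 1) ⊓ neF (varL 0) (varL 2) ⊓ neF (varL 0) (varL 3) ⊓
    neF (varL 1) (varL 2) ⊓ neF (varL 1) (varL 3) ⊓ neF (varL 2) (varL 3)) ⊓
  ((neF (varL 0) varX ⊓ neF (varL 0) (param a) ⊓ neF (varL 0) (param b)) ⊓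
    (neF (varL 1) varX ⊓ neF (varL 1) (param a) ⊓ neF (varL 1) (param b)) ⊓
    (neF (varL 2) varX ⊓ neF (varL 2) (param a) ⊓ neF (varL 2) (param b)) ⊓
    (neF (varL 3) varX ⊓ neF (varL 3) (param a) ⊓ neF (varL 3) (param b))) ⊓
  (adjF varX (varL 0) ⊓ adjF (varL 0) (varL 1) ⊓ adjF (varL 1) (varL 2) ⊓
    adjF (varL 2) (varL 3) ⊓ adjF (varL 3) (varL 0) ⊓ adjF (varL 1) (param a) ⊓
    adjF (varL 3) (param a) ⊓ adjF (varL 2) (param b))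

/-- The label formula `f(x, a, b)`. -/
def labelFormula (a b : V) : (LM V).Formula (Fin 1) :=
  (neF (Language.Term.var (Sum.inl 0)) (param a) ⊓
    neF (Language.Term.var (Sum.inl 0)) (param b) ⊓
    neF (param a) (param b) ⊓ adjF (param a) (param b)) ⊓
  ∃' ∃' ∃' ∃' (labelBody a b)

variable {G}

/-- The type `p(x)` encodes the point `τ` of `2^{M²}`. -/
def Encodes (p : TypeSpace G) (τ : V × V → Bool) : Prop :=
  (∀ a b : V, τ (a, b) = true → Contains p (labelFormula a b)) ∧
    ∀ a b : V, ¬ τ (a, b) = true → Contains p (∼(labelFormula a b))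

open Classical in
/-- The decoding map `u : S_1(M) → 2^{M²}`, `u(p) = {(a, b) : f(x, a, b) ∈ p}`. -/
noncomputable def decode (p : TypeSpace G) : V × V → Bool :=
  fun ab => decide (Contains p (labelFormula ab.1 ab.2))

end Types

end Encoding

/-!
# Encoding 2-orientations by types over a Fraïssé limit

Given a finite `d`-closed set `A` of `M` and a 2-orientation `τ`, attach to `G[A]` one new vertex
`x` and, for every pair `(a, b) ∈ τ` in `A`, a 4-cycle witnessing the label formula for `x`, `a`,
`b` (`labelExt`). Each vertex of the 4-cycle pays for the edge to its successor and for its edge to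
`x`, `a` or `b`, so a complete label does not change the predimension, and every proper part of a
label raises it (`labelGain`, `le_predim_labelExt`). Hence `A` is `d`-closed in the extension. Since
a set of `m` vertices carries at most `2 m` pairs of `τ`, a set of the extension with `m ≥ 2`
vertices in `A` has at most `m + 1 + 8 m` vertices, up to parts that pay for themselves, and
the bound on `F'` gives `F (9 m + 1) ≤ F m + 2`, where `2` is the predimension of `x`. This puts the
extension in `C_F` (`inCF_labelExt`), small sets being checked separately.

By the extension property of `M` the extension has a `d`-closed copy over `A`. A `d`-closed set
contains every label on its own vertices (`IsLabel.mem_of_dClosedIn`), and in the extension the only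
labels at `x` with parameters in `A` are the attached ones (`exists_of_isLabel_labelExt`). So the
image of `x` satisfies the label formula exactly at the pairs of `τ` in `A`
(`IsFraisseLimit.exists_encoding_vertex`): the types of the vertices of `M` decode to points dense
around `τ`, and the range of the decoding map is closed because the type space is compact.

Finally, a 2-orientation exists by Hall's theorem, since a finite set `X` of vertices of `M` spans at
most `2 |X|` edges; the 2-orientations form a closed invariant set because being one is a conjunction
of invariant conditions on at most three coordinates each.
-/

namespace Encoding

/-! ### Growth of the control function -/

section Growth

variable {F : ℝ → ℝ}

/-- As the right derivative is antitone, its bound at `x` holds on all of `[x, ∞)`. -/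
theorem IsEncodingControl.le_add_slope (hF : IsEncodingControl F) {x y : ℝ} (hx : 2 ≤ x)
    (hxy : x ≤ y) : F y ≤ F x + 2 / (8 * x + 1) * (y - x) := by
  refine image_le_of_deriv_right_le_deriv_boundary (f := F) (f' := rightDeriv F) (a := x) (b := y)
    (B := fun z => F x + 2 / (8 * x + 1) * (z - x)) (B' := fun _ => 2 / (8 * x + 1))
    (hF.continuousOn.mono fun z hz => ?_) (fun z hz => ?_) (by simp) (by fun_prop)
    (fun z _ => ?_) (fun z hz => ?_) ⟨hxy, le_rfl⟩
  · exact (by linarith [hz.1] : (0 : ℝ) ≤ z)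
  · exact (hF.differentiable_right z (by linarith [hz.1])).hasDerivWithinAt.Ici_of_Ioi
  · have h := (((hasDerivAt_id z).sub_const x).const_mul (2 / (8 * x + 1))).const_add (F x)
    simpa using h.hasDerivWithinAt
  · exact (hF.rightDeriv_antitone (show (0 : ℝ) < x by linarith)
      (show (0 : ℝ) < z by linarith [hz.1]) hz.1).trans (hF.rightDeriv_le x hx)

theorem IsEncodingControl.le_add_of_two_le (hF : IsEncodingControl F) {n k : ℕ} (hn : 2 ≤ n) :
    F ((n + k : ℕ) : ℝ) ≤ F n + 2 / 17 * k := by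
  have hn' : (2 : ℝ) ≤ n := by exact_mod_cast hn
  have h := hF.le_add_slope (y := (n + k : ℕ)) hn' (by push_cast; linarith [k.cast_nonneg (α := ℝ)])
  have h2 : (2 : ℝ) / (8 * n + 1) ≤ 2 / 17 := by gcongr; linarith
  have h3 := mul_le_mul_of_nonneg_right h2 (k.cast_nonneg (α := ℝ))
  push_cast at h ⊢
  rw [add_sub_cancel_left] at h
  linarith

/-- The derivative bound is made for this inequality: a new vertex, together with at most two labels
of four vertices for each of `n` old vertices, may be paid for with `2`. -/
theorem IsEncodingControl.le_add_two (hF : IsEncodingControl F) {n : ℕ} (hn : 2 ≤ n) :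
    F ((n + 1 + 8 * n : ℕ) : ℝ) ≤ F n + 2 := by
  have hn' : (2 : ℝ) ≤ n := by exact_mod_cast hn
  have h := hF.le_add_slope (y := (n + 1 + 8 * n : ℕ)) hn' (by push_cast; linarith)
  have h2 : (2 : ℝ) / (8 * n + 1) * (8 * n + 1) = 2 := div_mul_cancel₀ _ (by positivity)
  have h3 : ((n + 1 + 8 * n : ℕ) : ℝ) - n = 8 * n + 1 := by push_cast; ring
  rw [h3, h2] at h
  exact h

theorem IsControl.mono_nat (hF : IsControl F) {m n : ℕ} (h : m ≤ n) : F m ≤ F n :=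
  hF.strictMonoOn.monotoneOn (Set.mem_Ici.2 m.cast_nonneg) (Set.mem_Ici.2 n.cast_nonneg)
    (by exact_mod_cast h)

theorem IsControl.pos_nat (hF : IsControl F) {n : ℕ} (h : 0 < n) : 0 < F n := by
  have := hF.strictMonoOn Set.self_mem_Ici (Set.mem_Ici.2 n.cast_nonneg)
    (by exact_mod_cast h : (0 : ℝ) < n)
  rwa [hF.map_zero] at this

end Growth

/-! ### Predimension and `d`-closed sets -/

section Predimension

variable {V W : Type*} {G : SimpleGraph V} {H : SimpleGraph W} {F : ℝ → ℝ}

@[simp]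
theorem mk_mem_edgesIn {S : Finset V} {a b : V} :
    s(a, b) ∈ edgesIn G S ↔ (a ∈ S ∧ b ∈ S) ∧ G.Adj a b := by
  simp [edgesIn]

theorem InCF.mono {S T : Finset V} (h : InCF G F T) (hST : S ⊆ T) : InCF G F S :=
  ⟨fun B hB => h.1 B (hB.trans hST), fun B hB => h.2 B (hB.trans hST)⟩

open Classical in
theorem edgesIn_map (e : H ↪g G) (S : Finset W) :
    edgesIn G (S.map e.toEmbedding) = (edgesIn H S).map e.toEmbedding.sym2Map := by
  ext p
  induction p with | _ x y
  simp only [mk_mem_edgesIn, Finset.mem_map]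
  constructor
  · rintro ⟨⟨⟨a, ha, rfl⟩, ⟨b, hb, rfl⟩⟩, hab⟩
    exact ⟨s(a, b), mk_mem_edgesIn.2 ⟨⟨ha, hb⟩, e.map_rel_iff.1 hab⟩, rfl⟩
  · rintro ⟨q, hq, hqe⟩
    induction q with | _ a b
    obtain ⟨⟨ha, hb⟩, hab⟩ := mk_mem_edgesIn.1 hq
    have h1 : s(e a, e b) = s(x, y) := hqe
    have h2 : s(x, y) ∈ edgesIn G (S.map e.toEmbedding) := by
      rw [← h1]
      exact mk_mem_edgesIn.2 ⟨⟨Finset.mem_map_of_mem _ ha, Finset.mem_map_of_mem _ hb⟩,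
        e.map_rel_iff.2 hab⟩
    simpa only [mk_mem_edgesIn, Finset.mem_map] using h2

theorem predim_map (e : H ↪g G) (S : Finset W) :
    predim G (S.map e.toEmbedding) = predim H S := by
  rw [predim, predim, edgesIn_map, Finset.card_map, Finset.card_map]

theorem InCF.of_map (e : H ↪g G) {S : Finset W} (h : InCF G F (S.map e.toEmbedding)) :
    InCF H F S := by
  refine ⟨fun B hB hne => ?_, fun B hB => ?_⟩
  · rw [← predim_map e]
    exact h.1 _ (Finset.map_subset_map.2 hB) (hne.map)
  · rw [← predim_map e, ← Finset.card_map e.toEmbedding]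
    exact h.2 _ (Finset.map_subset_map.2 hB)

open Classical in
theorem predim_submodular (X Y : Finset V) :
    predim G (X ∪ Y) + predim G (X ∩ Y) ≤ predim G X + predim G Y := by
  have h1 : edgesIn G X ∪ edgesIn G Y ⊆ edgesIn G (X ∪ Y) := by
    intro p
    induction p with | _ x y
    simp only [Finset.mem_union, mk_mem_edgesIn]
    tauto
  have h2 : edgesIn G X ∩ edgesIn G Y = edgesIn G (X ∩ Y) := by
    ext p
    induction p with | _ x y
    simp only [Finset.mem_inter, mk_mem_edgesIn]
    tauto
  have h3 := Finset.card_union_add_card_inter (edgesIn G X) (edgesIn G Y)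
  have h4 := Finset.card_le_card h1
  have h5 := Finset.card_union_add_card_inter X Y
  rw [h2] at h3
  simp only [predim]
  omega

theorem DClosed.mono {A B C : Finset V} (h : DClosed G A C) (hAB : A ⊆ B) (hBC : B ⊆ C) :
    DClosed G A B :=
  ⟨hAB, fun D hD hDB => h.2 D hD (hDB.trans hBC)⟩

theorem DClosed.predim_le {A B C : Finset V} (h : DClosed G A B) (hAC : A ⊆ C) (hCB : C ⊆ B) :
    predim G A ≤ predim G C := by
  rcases hAC.eq_or_ssubset with rfl | h'
  · exact le_rfl
  · exact (h.2 C h' hCB).le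

open Classical in
theorem DClosed.trans {A B C : Finset V} (h₁ : DClosed G A B) (h₂ : DClosed G B C) :
    DClosed G A C := by
  refine ⟨h₁.1.trans h₂.1, fun X hAX hXC => ?_⟩
  have hsub := predim_submodular (G := G) X B
  have hle := h₁.predim_le (Finset.subset_inter hAX.1 h₁.1) Finset.inter_subset_right
  by_cases hXB : X ⊆ B
  · exact h₁.2 X hAX hXB
  · have := h₂.2 (X ∪ B) ⟨Finset.subset_union_right,
      fun h => hXB (Finset.subset_union_left.trans h)⟩ (Finset.union_subset hXC h₂.1)
    omega

open Classical in
theorem DClosed.dClosedIn {A B : Finset V} (h₁ : DClosed G A B) (h₂ : DClosedIn G B) :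
    DClosedIn G A := fun X hX =>
  (h₁.trans (h₂ (X ∪ B) Finset.subset_union_right)).mono hX Finset.subset_union_left

theorem DClosed.map (e : H ↪g G) {A B : Finset W} (h : DClosed H A B) :
    DClosed G (A.map e.toEmbedding) (B.map e.toEmbedding) := by
  refine ⟨Finset.map_subset_map.2 h.1, fun C hAC hCB => ?_⟩
  obtain ⟨D, hDB, rfl⟩ := Finset.subset_map_iff.1 hCB
  rw [predim_map, predim_map]
  exact h.2 D (Finset.map_ssubset_map.1 hAC) hDB

theorem DClosedIn.map (g : G ≃g G) {A : Finset V} (h : DClosedIn G A) :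
    DClosedIn G (A.map g.toEmbedding.toEmbedding) := fun X hX => by
  have key : X = (X.map g.symm.toEmbedding.toEmbedding).map g.toEmbedding.toEmbedding := by
    ext v
    simp only [Finset.map_map, Finset.mem_map]
    exact ⟨fun hv => ⟨v, hv, g.apply_symm_apply v⟩,
      fun ⟨u, hu, huv⟩ => (g.apply_symm_apply u).symm.trans huv ▸ hu⟩
  rw [key]
  refine (h _ fun a ha => ?_).map g.toEmbedding
  exact Finset.mem_map.2 ⟨g a, hX (Finset.mem_map_of_mem _ ha), g.symm_apply_apply a⟩

theorem dClosed_refl (A : Finset V) : DClosed G A A :=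
  ⟨subset_rfl, fun _ h h' => (h.2 h').elim⟩

end Predimension

/-! ### The extension property of the Fraïssé limit -/

section FraisseLimit

variable {V W : Type*} {G : SimpleGraph V} {H : SimpleGraph W} {F : ℝ → ℝ}

theorem IsFraisseLimit.exists_dClosedIn_superset (hG : IsFraisseLimit F G) (X : Finset V) :
    ∃ A : Finset V, X ⊆ A ∧ DClosedIn G A ∧ InCF G F A := by
  classical
  obtain ⟨A, hCF, hd, hun⟩ := hG.chain
  have hle : ∀ i j, i ≤ j → DClosed G (A i) (A j) := by
    intro i j hij
    induction j, hij using Nat.le_induction with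
    | base => exact dClosed_refl _
    | succ j _ ih => exact ih.trans (hd j)
  have hcov : ∀ Y : Finset V, ∃ N, ∀ j ≥ N, Y ⊆ A j := by
    intro Y
    choose n hn using hun
    refine ⟨Y.sup n, fun j hj y hy => ?_⟩
    exact (hle _ _ ((Finset.le_sup hy).trans hj)).1 (hn y)
  obtain ⟨N, hN⟩ := hcov X
  refine ⟨A N, hN N le_rfl, fun Y hY => ?_, hCF N⟩
  obtain ⟨K, hK⟩ := hcov Y
  exact (hle N (max N K) (le_max_left _ _)).mono hY (hK _ (le_max_right _ _))

/-- A `d`-closed finite set `A` of `M` extends, over `A`, to a `d`-closed copy of any `≤_d`-extension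
of `G[A]` in the class `C_F`. -/
theorem IsFraisseLimit.extension (hG : IsFraisseLimit F G) [Fintype W]
    (hH : InCF H F Finset.univ) {A : Finset V} (hA : DClosedIn G A)
    (i : G.induce (A : Set V) ↪g H) {J : Finset W} (hJ : ∀ w, w ∈ J ↔ w ∈ Set.range i)
    (hJd : DClosed H J Finset.univ) :
    ∃ e : H ↪g G, DClosedIn G (Finset.univ.map e.toEmbedding) ∧
      ∀ a : (A : Set V), e (i a) = a := by
  classical
  let ε : W ≃ Fin (Fintype.card W) := Fintype.equivFin W
  let H' : SimpleGraph (Fin (Fintype.card W)) := H.comap ε.symm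
  let ι : H ≃g H' := ⟨ε, by intro a b; simp [H']⟩
  have hH' : InCF H' F Finset.univ :=
    InCF.of_map ι.symm.toEmbedding (hH.mono (Finset.subset_univ _))
  obtain ⟨e₀', he₀'⟩ := hG.age _ H' hH'
  let e₀ : H ↪g G := e₀'.comp ι.toEmbedding
  have he₀ : DClosedIn G (Finset.univ.map e₀.toEmbedding) := by
    have h : Finset.univ.map e₀.toEmbedding = Finset.univ.map e₀'.toEmbedding := by
      ext v
      simp only [Finset.mem_map, Finset.mem_univ, true_and]
      constructor
      · rintro ⟨w, rfl⟩
        exact ⟨ι w, rfl⟩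
      · rintro ⟨w, rfl⟩
        exact ⟨ι.symm w, congrArg e₀' (ι.apply_symm_apply w)⟩
    rwa [h]
  have hA' : DClosedIn G (J.map e₀.toEmbedding) := (hJd.map e₀).dClosedIn he₀
  have hmem : ∀ a, e₀ (i a) ∈ (J.map e₀.toEmbedding : Finset V) := fun a =>
    Finset.mem_map_of_mem _ ((hJ _).2 ⟨a, rfl⟩)
  let f : G.induce (A : Set V) ≃g G.induce (J.map e₀.toEmbedding : Finset V) :=
    { Equiv.ofBijective (fun a => ⟨e₀ (i a), hmem a⟩) (by
        constructor
        · intro a b hab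
          exact i.injective (e₀.injective (congrArg Subtype.val hab))
        · rintro ⟨v, hv⟩
          obtain ⟨w, hw, rfl⟩ := Finset.mem_map.1 hv
          obtain ⟨a, rfl⟩ := (hJ w).1 hw
          exact ⟨a, rfl⟩) with
      map_rel_iff' := by
        intro a b
        exact e₀.map_rel_iff.trans i.map_rel_iff }
  obtain ⟨g, hg⟩ := hG.ultrahomogeneous A _ hA hA' f
  refine ⟨g.symm.toEmbedding.comp e₀, ?_, fun a => ?_⟩
  · have h := he₀.map g.symm
    rw [Finset.map_map] at h
    exact h
  · change g.symm (e₀ (i a)) = a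
    rw [RelIso.symm_apply_eq]
    exact (hg a).symm

end FraisseLimit

/-! ### Attaching a labelling vertex to a finite graph -/

section LabelExt

variable {α ι : Type*} (G₀ : SimpleGraph α) (s t : ι → α)

/-- The neighbour of the label vertex `l_{j+1}` of the pair `(s i, t i)` that lies off the `4`-cycle
of the label: the labelling vertex `none` for `j = 0`, the source `s i` for `j = 1, 3`, and the
target `t i` for `j = 2`. -/
def spoke (i : ι) : Fin 4 → Option α :=
  ![none, some (s i), some (t i), some (s i)]

/-- The graph obtained from `G₀` by adding an isolated vertex `none` and then, for every `i : ι`, a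
`4`-cycle of label vertices `(i, 0), …, (i, 3)` that witnesses the label formula for `none` and the
pair `(s i, t i)`. -/
def labelExt : SimpleGraph (Option α ⊕ ι × Fin 4) where
  Adj
    | .inl u, .inl v => (G₀.map Function.Embedding.some).Adj u v
    | .inl u, .inr p => u = spoke s t p.1 p.2
    | .inr p, .inl u => u = spoke s t p.1 p.2
    | .inr p, .inr q => p.1 = q.1 ∧ (q.2 = p.2 + 1 ∨ p.2 = q.2 + 1)
  symm := ⟨by
    rintro (u | p) (v | q) h
    · exact SimpleGraph.Adj.symm h
    · exact h
    · exact h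
    · exact ⟨h.1.symm, h.2.symm⟩⟩
  loopless := ⟨by
    rintro (u | p) h
    · exact SimpleGraph.irrefl _ h
    · have : ∀ j : Fin 4, ¬(j = j + 1 ∨ j = j + 1) := by decide
      exact this _ h.2⟩

/-- The embedding of the old vertices into the extended graph. -/
def baseEmb : G₀ ↪g labelExt G₀ s t where
  toFun a := .inl (some a)
  inj' _ _ h := Option.some_injective _ (Sum.inl_injective h)
  map_rel_iff' {a b} := by
    change (G₀.map Function.Embedding.some).Adj (some a) (some b) ↔ G₀.Adj a b
    exact SimpleGraph.map_adj_apply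

/-- The contribution to the predimension of the vertices of one label that lie in a set: `P` records
which of the four label vertices lie in the set, and `q` which of their spokes end in it. A label
vertex contributes `2`, less `1` for its spoke and `1` for the edge to its successor on the cycle. -/
def labelGain (P q : Fin 4 → Bool) : ℤ :=
  ∑ j, if P j then 2 - (if q j then 1 else 0) - (if P (j + 1) then 1 else 0) else 0

/-- The number of label vertices of one label that lie in a set. -/
def labelCount (P : Fin 4 → Bool) : ℕ :=
  ∑ j, if P j then 1 else 0

theorem labelGain_nonneg : ∀ P q, 0 ≤ labelGain P q := by decide +kernel

theorem labelCount_le_four : ∀ P, labelCount P ≤ 4 := by decide +kernel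

/-- Unless `x`, `a`, `b` are all present, a label contributes at least `1 / 4` for each of its
vertices. -/
theorem labelCount_le_of_spokes_ne : ∀ P q : Fin 4 → Bool, q 3 = q 1 → ¬(q 0 ∧ q 1 ∧ q 2) →
    (labelCount P : ℤ) ≤ 4 * labelGain P q := by decide +kernel

/-- The contribution of a label of which at most one of the parameters `x`, `a`, `b` is present. The
second inequality is sharp for one and for four label vertices, and summing over several labels needs
it for only one of them. -/
theorem labelCount_add_two_le : ∀ P q : Fin 4 → Bool, q 3 = q 1 →
    ¬(q 0 ∧ q 1 ∨ q 0 ∧ q 2 ∨ q 1 ∧ q 2) →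
    (labelCount P : ℤ) ≤ 3 * labelGain P q ∧
      (0 < labelCount P → (labelCount P : ℤ) + 2 ≤ 3 * labelGain P q) := by decide +kernel

/-- The contribution of a label of which none of the parameters is present. -/
theorem two_mul_labelCount_add_four_le : ∀ P q : Fin 4 → Bool, (∀ j, q j = false) →
    2 * (labelCount P : ℤ) ≤ 3 * labelGain P q ∧
      (0 < labelCount P → 2 * (labelCount P : ℤ) + 4 ≤ 3 * labelGain P q) := by decide +kernel

variable [Fintype α] [Fintype ι] [DecidableEq α] [DecidableEq ι]

/-- The old vertices in a set of vertices of the extended graph. -/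
def basePart (C : Finset (Option α ⊕ ι × Fin 4)) : Finset α :=
  Finset.univ.filter fun a => Sum.inl (some a) ∈ C

/-- The indicator of the label vertices of the pair `i` in `C`. -/
def labelPart (C : Finset (Option α ⊕ ι × Fin 4)) (i : ι) (j : Fin 4) : Bool :=
  decide (Sum.inr (i, j) ∈ C)

/-- The indicator of the spokes of the pair `i` that end in `C`. -/
def spokePart (C : Finset (Option α ⊕ ι × Fin 4)) (i : ι) (j : Fin 4) : Bool :=
  decide (Sum.inl (spoke s t i j) ∈ C)

theorem card_eq_basePart (C : Finset (Option α ⊕ ι × Fin 4)) :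
    C.card = (basePart C).card + (if Sum.inl none ∈ C then 1 else 0) +
      ∑ i, labelCount (labelPart C i) := by
  have h : C.card = ∑ w, if w ∈ C then 1 else 0 := by
    rw [← Finset.card_filter, Finset.filter_univ_mem]
  rw [h, Fintype.sum_sum_type, Fintype.sum_option, Fintype.sum_prod_type, basePart,
    Finset.card_filter, add_comm (ite _ _ _)]
  simp [labelCount, labelPart]

theorem card_edgesIn_labelExt_le (C : Finset (Option α ⊕ ι × Fin 4)) :
    (edgesIn (labelExt G₀ s t) C).card ≤ (edgesIn G₀ (basePart C)).card +
      (∑ i, ∑ j, if labelPart C i j ∧ spokePart s t C i j then 1 else 0) +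
      ∑ i, ∑ j, if labelPart C i j ∧ labelPart C i (j + 1) then 1 else 0 := by
  rw [← Fintype.sum_prod_type' (fun i j => if labelPart C i j ∧ spokePart s t C i j then 1 else 0),
    ← Fintype.sum_prod_type' (fun i j => if labelPart C i j ∧ labelPart C i (j + 1) then 1 else 0),
    ← Finset.card_filter, ← Finset.card_filter]
  refine (Finset.card_le_card (t := (edgesIn G₀ (basePart C)).map
      (baseEmb G₀ s t).toEmbedding.sym2Map ∪
    (Finset.univ.filter fun p : ι × Fin 4 => labelPart C p.1 p.2 ∧ spokePart s t C p.1 p.2).image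
      (fun p => s(Sum.inr p, Sum.inl (spoke s t p.1 p.2))) ∪
    (Finset.univ.filter fun p : ι × Fin 4 => labelPart C p.1 p.2 ∧ labelPart C p.1 (p.2 + 1)).image
      (fun p => s(Sum.inr p, Sum.inr (p.1, p.2 + 1)))) ?_).trans ?_
  · have key : ∀ x y, x ∈ C → y ∈ C → (labelExt G₀ s t).Adj x y →
        s(x, y) ∈ (edgesIn G₀ (basePart C)).map (baseEmb G₀ s t).toEmbedding.sym2Map ∨
        s(x, y) ∈ (Finset.univ.filter fun p : ι × Fin 4 =>
          labelPart C p.1 p.2 ∧ spokePart s t C p.1 p.2).image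
          (fun p => s(Sum.inr p, Sum.inl (spoke s t p.1 p.2))) ∨
        s(x, y) ∈ (Finset.univ.filter fun p : ι × Fin 4 =>
          labelPart C p.1 p.2 ∧ labelPart C p.1 (p.2 + 1)).image
          (fun p => s(Sum.inr p, Sum.inr (p.1, p.2 + 1))) := by
      rintro (u | p) (v | q) hx hy h
      · left
        obtain ⟨a, b, hab, rfl, rfl⟩ := (SimpleGraph.map_adj _ _ _ _).1 h
        exact Finset.mem_map.2 ⟨s(a, b), mk_mem_edgesIn.2
          ⟨⟨by simpa [basePart] using hx, by simpa [basePart] using hy⟩, hab⟩, rfl⟩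
      · right; left
        obtain rfl : u = spoke s t q.1 q.2 := h
        exact Finset.mem_image.2 ⟨q, by simpa [labelPart, spokePart] using ⟨hy, hx⟩, Sym2.eq_swap⟩
      · right; left
        obtain rfl : v = spoke s t p.1 p.2 := h
        exact Finset.mem_image.2 ⟨p, by simpa [labelPart, spokePart] using ⟨hx, hy⟩, rfl⟩
      · right; right
        obtain ⟨i, j⟩ := p
        obtain ⟨i', k⟩ := q
        obtain ⟨rfl, h⟩ : i = i' ∧ (k = j + 1 ∨ j = k + 1) := h
        rcases h with rfl | rfl
        · exact Finset.mem_image.2 ⟨(i, j), by simpa [labelPart] using ⟨hx, hy⟩, rfl⟩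
        · exact Finset.mem_image.2 ⟨(i, k), by simpa [labelPart] using ⟨hy, hx⟩, Sym2.eq_swap⟩
    intro p
    induction p with | _ x y
    intro h
    obtain ⟨⟨hx, hy⟩, h⟩ := mk_mem_edgesIn.1 h
    rw [Finset.mem_union, Finset.mem_union, or_assoc]
    exact key x y hx hy h
  · refine (Finset.card_union_le _ _).trans (Nat.add_le_add ((Finset.card_union_le _ _).trans
      (Nat.add_le_add (Finset.card_map _).le Finset.card_image_le)) Finset.card_image_le)

/-- The predimension of a set of vertices of the extended graph is at least the predimension of its
old part, plus `2` for the labelling vertex, plus the contributions of the labels. -/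
theorem le_predim_labelExt (C : Finset (Option α ⊕ ι × Fin 4)) :
    predim G₀ (basePart C) + (if Sum.inl none ∈ C then 2 else 0) +
      ∑ i, labelGain (labelPart C i) (spokePart s t C i) ≤ predim (labelExt G₀ s t) C := by
  have h1 := card_eq_basePart C
  have h2 := card_edgesIn_labelExt_le G₀ s t C
  have h3 : ∑ i, labelGain (labelPart C i) (spokePart s t C i) =
      2 * ((∑ i, labelCount (labelPart C i) : ℕ) : ℤ) -
      ((∑ i, ∑ j, if labelPart C i j ∧ spokePart s t C i j then 1 else 0 : ℕ) : ℤ) -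
      ((∑ i, ∑ j, if labelPart C i j ∧ labelPart C i (j + 1) then 1 else 0 : ℕ) : ℤ) := by
    push_cast
    rw [Finset.mul_sum, ← Finset.sum_sub_distrib, ← Finset.sum_sub_distrib]
    refine Finset.sum_congr rfl fun i _ => ?_
    rw [labelGain, labelCount]
    push_cast
    rw [Finset.mul_sum, ← Finset.sum_sub_distrib, ← Finset.sum_sub_distrib]
    refine Finset.sum_congr rfl fun j _ => ?_
    cases labelPart C i j <;> simp
  rw [h3, predim, predim, h1]
  split_ifs at h1 ⊢ <;> omega

/-- The old vertices are `d`-closed in the extended graph. -/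
theorem dClosed_base :
    DClosed (labelExt G₀ s t) (Finset.univ.map (baseEmb G₀ s t).toEmbedding) Finset.univ := by
  refine ⟨Finset.subset_univ _, fun C hC _ => ?_⟩
  have hbase : basePart C = Finset.univ := by
    ext a
    exact iff_of_true (Finset.mem_filter.2 ⟨Finset.mem_univ a, hC.1
      (Finset.mem_map_of_mem (baseEmb G₀ s t).toEmbedding (Finset.mem_univ a))⟩) (Finset.mem_univ a)
  have h := le_predim_labelExt G₀ s t C
  rw [predim_map]
  rw [hbase] at h
  have hnn : ∀ i, 0 ≤ labelGain (labelPart C i) (spokePart s t C i) := fun i =>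
    labelGain_nonneg _ _
  have hsum := Finset.sum_nonneg fun i (_ : i ∈ Finset.univ) => hnn i
  by_cases hx : Sum.inl none ∈ C
  · rw [if_pos hx] at h
    omega
  rw [if_neg hx] at h
  obtain ⟨w, hw, hwn⟩ := Finset.exists_of_ssubset hC
  rcases w with (_ | a) | ⟨i, j⟩
  · exact (hx hw).elim
  · exact (hwn (Finset.mem_map_of_mem (baseEmb G₀ s t).toEmbedding (Finset.mem_univ a))).elim
  · have h0 : spokePart s t C i 0 = false := decide_eq_false hx
    have h1 := labelCount_le_of_spokes_ne (labelPart C i) (spokePart s t C i) rfl (by simp [h0])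
    have h2 : 0 < labelCount (labelPart C i) :=
      Finset.sum_pos' (fun _ _ => Nat.zero_le _) ⟨j, Finset.mem_univ _, by simp [labelPart, hw]⟩
    have h3 := Finset.single_le_sum (fun i _ => hnn i) (Finset.mem_univ i)
    omega

/-- A base graph in `C_F` and at most two labels per source vertex give an extension in `C_F`. The
slope of `F` is at most `2 / 17 < 1 / 4` from `2` on, so labels that raise the predimension pay for
their vertices there. Below `2` the values `F 0`, `F 1`, `F 2` leave less room, and sets with at most
one vertex outside the labels need the finer estimates of the contributions. -/
theorem inCF_labelExt {F : ℝ → ℝ} (hF : IsEncodingControl F) (hne : ∀ i, s i ≠ t i)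
    (hout : ∀ a, (Finset.univ.filter fun i => s i = a).card ≤ 2)
    (hG₀ : InCF G₀ F Finset.univ) : InCF (labelExt G₀ s t) F Finset.univ := by
  suffices hle : ∀ C : Finset (Option α ⊕ ι × Fin 4),
      F (C.card : ℝ) ≤ (predim (labelExt G₀ s t) C : ℝ) from
    ⟨fun C _ hC => by
      exact_mod_cast (hF.pos_nat hC.card_pos).trans_le (hle C), fun C _ => hle C⟩
  intro C
  have hδ : ((predim G₀ (basePart C) + (if Sum.inl none ∈ C then 2 else 0) +
      ∑ i, labelGain (labelPart C i) (spokePart s t C i) : ℤ) : ℝ) ≤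
      predim (labelExt G₀ s t) C := by exact_mod_cast le_predim_labelExt G₀ s t C
  refine le_trans ?_ hδ
  rw [card_eq_basePart C]
  have hbase : F ((basePart C).card : ℝ) ≤ predim G₀ (basePart C) :=
    hG₀.2 _ (Finset.subset_univ _)
  have hq : ∀ i, spokePart s t C i 3 = spokePart s t C i 1 := fun i => rfl
  have hq1 : ∀ i, spokePart s t C i 1 = true → s i ∈ basePart C := fun i h =>
    Finset.mem_filter.2 ⟨Finset.mem_univ _, of_decide_eq_true h⟩
  have hq2 : ∀ i, spokePart s t C i 2 = true → t i ∈ basePart C := fun i h =>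
    Finset.mem_filter.2 ⟨Finset.mem_univ _, of_decide_eq_true h⟩
  have hnn : ∀ i, 0 ≤ labelGain (labelPart C i) (spokePart s t C i) := fun i =>
    labelGain_nonneg _ _
  have h12 : ∀ i, spokePart s t C i 1 = true → spokePart s t C i 2 = true →
      2 ≤ (basePart C).card := fun i h1 h2 => Finset.one_lt_card.2 ⟨_, hq1 i h1, _, hq2 i h2, hne i⟩
  have hpos : 0 < ∑ i, labelCount (labelPart C i) → ∃ i, 0 < labelCount (labelPart C i) := by
    intro h
    obtain ⟨i, -, hi⟩ := Finset.exists_ne_zero_of_sum_ne_zero h.ne'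
    exact ⟨i, Nat.pos_of_ne_zero hi⟩
  set K := ∑ i, labelCount (labelPart C i) with hK
  set Γ := ∑ i, labelGain (labelPart C i) (spokePart s t C i) with hΓ
  set m := (basePart C).card with hm
  have hΓ0 : 0 ≤ Γ := Finset.sum_nonneg fun i _ => hnn i
  have hΓ0' : (0 : ℝ) ≤ Γ := by exact_mod_cast hΓ0
  -- If no label has all its spokes in `C`, then every label vertex contributes at least `1 / 4`.
  have hquarter : (∀ i, ¬(spokePart s t C i 0 ∧ spokePart s t C i 1 ∧ spokePart s t C i 2)) →
      (K : ℝ) ≤ 4 * Γ := by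
    intro h
    have : (K : ℤ) ≤ 4 * Γ := by
      rw [hK, hΓ, Finset.mul_sum]
      push_cast
      exact Finset.sum_le_sum fun i _ => labelCount_le_of_spokes_ne _ _ (hq i) (h i)
    exact_mod_cast this
  -- If every label has at most one spoke end in `C`, labels contribute more.
  have hthird : (∀ i, ¬(spokePart s t C i 0 ∧ spokePart s t C i 1 ∨
      spokePart s t C i 0 ∧ spokePart s t C i 2 ∨ spokePart s t C i 1 ∧ spokePart s t C i 2)) →
      0 < K → (K : ℤ) + 2 ≤ 3 * Γ := by
    intro h h0
    obtain ⟨i₀, hi₀⟩ := hpos h0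
    have key := fun i => labelCount_add_two_le (labelPart C i) (spokePart s t C i) (hq i) (h i)
    have := Finset.single_le_sum (f := fun i => 3 * labelGain (labelPart C i) (spokePart s t C i) -
      (labelCount (labelPart C i) : ℤ)) (fun i _ => sub_nonneg.2 (key i).1) (Finset.mem_univ i₀)
    rw [Finset.sum_sub_distrib, ← Finset.mul_sum, ← hΓ] at this
    have h2 := (key i₀).2 hi₀
    rw [hK]
    push_cast
    linarith
  -- If no spoke ends in `C`, they contribute even more.
  have hfour : (∀ i j, spokePart s t C i j = false) → 0 < K → 2 * (K : ℤ) + 4 ≤ 3 * Γ := by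
    intro h h0
    obtain ⟨i₀, hi₀⟩ := hpos h0
    have key := fun i => two_mul_labelCount_add_four_le (labelPart C i) (spokePart s t C i) (h i)
    have := Finset.single_le_sum (f := fun i => 3 * labelGain (labelPart C i) (spokePart s t C i) -
      2 * (labelCount (labelPart C i) : ℤ)) (fun i _ => sub_nonneg.2 (key i).1)
      (Finset.mem_univ i₀)
    rw [Finset.sum_sub_distrib, ← Finset.mul_sum, ← Finset.mul_sum, ← hΓ] at this
    have h2 := (key i₀).2 hi₀
    rw [hK]
    push_cast
    linarith
  have hone := hF.map_one
  have htwo := hF.map_two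
  -- The bound for the case of a single vertex of `C` off the labels.
  have hsingle : ((0 < K → (K : ℤ) + 2 ≤ 3 * Γ)) → F ((1 + K : ℕ) : ℝ) ≤ 2 + Γ := by
    intro h
    rcases Nat.eq_zero_or_pos K with h0 | h0
    · rw [h0, add_zero, Nat.cast_one, hone]
      linarith
    · have h1 := hF.le_add_of_two_le (n := 2) (k := K - 1) le_rfl
      have h2 : 2 + (K - 1) = 1 + K := by omega
      have h3 : (K : ℝ) + 2 ≤ 3 * Γ := by exact_mod_cast h h0
      rw [h2, Nat.cast_sub h0] at h1
      have h4 : (1 : ℝ) ≤ K := by exact_mod_cast h0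
      push_cast at h1 ⊢
      rw [htwo] at h1
      linarith
  by_cases hx : Sum.inl none ∈ C
  · simp only [if_pos hx]
    push_cast
    rcases lt_trichotomy m 1 with h0 | h1 | h2
    · -- `C` consists of the labelling vertex and label vertices.
      have h0' : m = 0 := by omega
      rw [h0', Nat.cast_zero, hF.map_zero] at hbase
      have hemp := Finset.card_eq_zero.1 (hm.symm.trans h0')
      have h := hsingle (hthird fun i hi => by
        rcases hi with hi | hi | hi
        · simpa [hemp] using hq1 i hi.2
        · simpa [hemp] using hq2 i hi.2
        · simpa [hemp] using hq2 i hi.2)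
      rw [h0', Nat.cast_zero, zero_add]
      push_cast at h
      linarith
    · -- A pair of `τ` needs two vertices of `A`, so no label has all its spokes in `C`.
      rw [h1, Nat.cast_one, hone] at hbase
      have h := hquarter fun i hi => by
        have := h12 i hi.2.1 hi.2.2
        omega
      have h2 := hF.le_add_of_two_le (n := 2) (k := K) le_rfl
      rw [h1]
      push_cast at h2
      norm_num at h2 ⊢
      linarith
    · -- Labels with all their spokes in `C` contribute nothing, but there are at most `2 m` of them.
      have hR : (Finset.univ.filter fun i => s i ∈ basePart C).card ≤ 2 * m := by
        refine Finset.card_le_mul_card_image_of_maps_to (f := s) (fun i hi => ?_) 2 fun a _ => ?_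
        · exact (Finset.mem_filter.1 hi).2
        · refine (Finset.card_le_card ?_).trans (hout a)
          intro i hi
          simp only [Finset.mem_filter, Finset.mem_univ, true_and] at hi ⊢
          exact hi.2
      have hKle : (K : ℤ) ≤ 8 * m + 4 * Γ := by
        have h : ∀ i, (labelCount (labelPart C i) : ℤ) ≤ 4 * (if s i ∈ basePart C then 1 else 0) +
            4 * labelGain (labelPart C i) (spokePart s t C i) := by
          intro i
          split_ifs with hi
          · have h4 := labelCount_le_four (labelPart C i)
            have := hnn i
            omega
          · have := labelCount_le_of_spokes_ne (labelPart C i) (spokePart s t C i) (hq i)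
              fun h => hi (hq1 i h.2.1)
            omega
        have h3 := Finset.sum_le_sum fun i (_ : i ∈ Finset.univ) => h i
        rw [Finset.sum_add_distrib, ← Finset.mul_sum, ← Finset.mul_sum, ← hΓ, ← Nat.cast_sum,
          ← hK, Finset.sum_boole] at h3
        omega
      obtain ⟨γ, hγ⟩ := Int.eq_ofNat_of_zero_le hΓ0
      rw [hγ] at hKle ⊢
      have h4 : m + 1 + K ≤ m + 1 + 8 * m + 4 * γ := by omega
      have h5 := hF.le_add_of_two_le (n := m + 1 + 8 * m) (k := 4 * γ) (by omega)
      have h6 := hF.le_add_two (n := m) h2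
      have h7 := hF.mono_nat h4
      have h8 : (0 : ℝ) ≤ γ := γ.cast_nonneg
      push_cast at h5 h6 h7 ⊢
      linarith
  · simp only [if_neg hx]
    push_cast
    have hq0' : ∀ i, spokePart s t C i 0 = false := fun i => decide_eq_false hx
    rcases lt_trichotomy m 1 with h0 | h1 | h2
    · have h0' : m = 0 := by omega
      have hemp := Finset.card_eq_zero.1 (hm.symm.trans h0')
      rw [h0', Nat.cast_zero, hF.map_zero] at hbase
      rw [h0']
      have hq1' : ∀ i, spokePart s t C i 1 = false := fun i => by
        by_contra h
        simpa [hemp] using hq1 i (by simpa using h)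
      have hq2' : ∀ i, spokePart s t C i 2 = false := fun i => by
        by_contra h
        simpa [hemp] using hq2 i (by simpa using h)
      have h := hfour fun i j => by
        fin_cases j
        · exact hq0' i
        · exact hq1' i
        · exact hq2' i
        · exact hq1' i
      -- `C` consists of label vertices only; `F` has slope at most `2 / 17` only from `2` on, so
      -- `K = 0` and `K = 1` are treated apart.
      rcases Nat.eq_zero_or_pos K with hK0 | hK0
      · simp only [hK0, Nat.cast_zero, add_zero, hF.map_zero]
        linarith
      have h := h hK0
      rcases Nat.lt_or_ge K 2 with hK1 | hK2
      · have hK1 : K = 1 := by omega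
        have : (2 : ℝ) ≤ Γ := by
          have : 2 ≤ Γ := by omega
          exact_mod_cast this
        simp only [hK1, Nat.cast_one, Nat.cast_zero, add_zero, zero_add, hone]
        linarith
      · have h1 := hF.le_add_of_two_le (n := 2) (k := K - 2) le_rfl
        rw [Nat.add_sub_cancel' hK2, Nat.cast_sub hK2, Nat.cast_two, htwo] at h1
        have h3 : 2 * (K : ℝ) + 4 ≤ 3 * Γ := by exact_mod_cast h
        have h4 : (K : ℝ) ≤ 2 ∨ (4 : ℝ) ≤ Γ := by
          by_cases hK3 : K ≤ 2
          · left
            exact_mod_cast hK3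
          · right
            have : 4 ≤ Γ := by omega
            exact_mod_cast this
        have h5 : (3 : ℝ) ≤ Γ := by
          have : 3 ≤ Γ := by omega
          exact_mod_cast this
        simp only [Nat.cast_zero, add_zero, zero_add]
        rcases h4 with h4 | h4 <;> linarith
    · rw [h1, Nat.cast_one, hone] at hbase
      have h := hsingle (hthird fun i hi => by
        rcases hi with hi | hi | hi
        · simp [hq0' i] at hi
        · simp [hq0' i] at hi
        · have := h12 i hi.1 hi.2
          omega)
      rw [h1]
      push_cast at h
      norm_num
      linarith
    · have h := hquarter fun i hi => by simp [hq0' i] at hi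
      have h3 := hF.le_add_of_two_le (n := m) (k := K) h2
      push_cast at h3
      norm_num
      linarith

end LabelExt

/-! ### The label formula in the Fraïssé limit -/

section LabelConfig

variable {V W : Type*} {G : SimpleGraph V} {H : SimpleGraph W}

/-- The vertices `l 0, …, l 3` form a `4`-cycle whose members are adjacent to `x`, `a`, `b`, `a`
respectively: this is what the label formula says of `l_1, …, l_4`. -/
structure IsLabel (G : SimpleGraph V) (x a b : V) (l : Fin 4 → V) : Prop where
  injective : Function.Injective l
  ne_spoke : ∀ j k, l j ≠ (![x, a, b, a] : Fin 4 → V) k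
  adj_next : ∀ j, G.Adj (l j) (l (j + 1))
  adj_spoke : ∀ j, G.Adj (l j) ((![x, a, b, a] : Fin 4 → V) j)

theorem IsLabel.map (e : H ↪g G) {x a b : W} {l : Fin 4 → W} (h : IsLabel H x a b l) :
    IsLabel G (e x) (e a) (e b) (e ∘ l) := by
  have key : (![e x, e a, e b, e a] : Fin 4 → V) = e ∘ ![x, a, b, a] := by
    funext j
    fin_cases j <;> rfl
  refine ⟨e.injective.comp h.injective, fun j k => ?_, fun j => e.map_rel_iff.2 (h.adj_next j),
    fun j => ?_⟩
  · rw [key]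
    exact fun h' => h.ne_spoke j k (e.injective h')
  · rw [key]
    exact e.map_rel_iff.2 (h.adj_spoke j)

theorem IsLabel.of_map (e : H ↪g G) {x a b : W} {l : Fin 4 → W}
    (h : IsLabel G (e x) (e a) (e b) (e ∘ l)) : IsLabel H x a b l := by
  have key : (![e x, e a, e b, e a] : Fin 4 → V) = e ∘ ![x, a, b, a] := by
    funext j
    fin_cases j <;> rfl
  refine ⟨h.injective.of_comp, fun j k h' => h.ne_spoke j k ?_,
    fun j => e.map_rel_iff.1 (h.adj_next j), fun j => e.map_rel_iff.1 ?_⟩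
  · rw [key]
    exact congrArg e h'
  · have := h.adj_spoke j
    rwa [key] at this

open Classical in
/-- A `d`-closed set that contains `x`, `a`, `b` contains every label of `(a, b)` at `x`: each label
vertex outside the set brings with it two edges, to its spoke and to its successor. -/
theorem IsLabel.mem_of_dClosedIn {x a b : V} {l : Fin 4 → V} (h : IsLabel G x a b l)
    {X : Finset V} (hX : DClosedIn G X) (hx : x ∈ X) (ha : a ∈ X) (hb : b ∈ X) (j : Fin 4) :
    l j ∈ X := by
  set c : Fin 4 → V := ![x, a, b, a] with hc
  have hcX : ∀ k, c k ∈ X := by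
    intro k
    fin_cases k
    · exact hx
    · exact ha
    · exact hb
    · exact ha
  set P : Finset (Fin 4) := Finset.univ.filter fun j => l j ∉ X with hP
  have hPX : ∀ j ∈ P, l j ∉ X := fun j hj => (Finset.mem_filter.1 hj).2
  by_contra hj
  have hPn : 0 < P.card := Finset.card_pos.2 ⟨j, Finset.mem_filter.2 ⟨Finset.mem_univ _, hj⟩⟩
  have hXC : X ⊆ X ∪ P.image l := Finset.subset_union_left
  have hlC : ∀ j, l j ∈ X ∪ P.image l := by
    intro j
    by_cases hj : l j ∈ X
    · exact Finset.mem_union_left _ hj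
    · exact Finset.mem_union_right _ (Finset.mem_image_of_mem _
        (Finset.mem_filter.2 ⟨Finset.mem_univ _, hj⟩))
  have hcard : (X ∪ P.image l).card = X.card + P.card := by
    rw [Finset.card_union_of_disjoint, Finset.card_image_of_injective _ h.injective]
    rw [Finset.disjoint_left]
    intro v hv hv'
    obtain ⟨j, hj, rfl⟩ := Finset.mem_image.1 hv'
    exact hPX j hj hv
  have hss : X ⊂ X ∪ P.image l := by
    refine Finset.ssubset_iff_subset_ne.2 ⟨hXC, fun he => ?_⟩
    have := congrArg Finset.card he
    omega
  have hlt := (hX _ hXC).2 _ hss subset_rfl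
  set E₁ := P.image fun j => s(l j, c j)
  set E₂ := P.image fun j => s(l j, l (j + 1))
  have hE₁ : E₁.card = P.card := by
    refine Finset.card_image_of_injective _ fun j k hjk => ?_
    rcases Sym2.eq_iff.1 hjk with h' | h'
    · exact h.injective h'.1
    · exact (h.ne_spoke j k h'.1).elim
  have hE₂ : E₂.card = P.card := by
    refine Finset.card_image_of_injective _ fun j k hjk => ?_
    rcases Sym2.eq_iff.1 hjk with h' | h'
    · exact h.injective h'.1
    · have h1 := h.injective h'.1
      have h2 := h.injective h'.2
      have : ∀ j k : Fin 4, j = k + 1 → j + 1 = k → j = k := by decide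
      exact this j k h1 h2
  have hd₁ : Disjoint (edgesIn G X) (E₁ ∪ E₂) := by
    rw [Finset.disjoint_left]
    intro e he he'
    rcases Finset.mem_union.1 he' with he' | he'
    · obtain ⟨j, hj, rfl⟩ := Finset.mem_image.1 he'
      exact hPX j hj (mk_mem_edgesIn.1 he).1.1
    · obtain ⟨j, hj, rfl⟩ := Finset.mem_image.1 he'
      exact hPX j hj (mk_mem_edgesIn.1 he).1.1
  have hd₂ : Disjoint E₁ E₂ := by
    rw [Finset.disjoint_left]
    intro e he he'
    obtain ⟨j, hj, rfl⟩ := Finset.mem_image.1 he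
    obtain ⟨k, hk, hjk⟩ := Finset.mem_image.1 he'
    rcases Sym2.eq_iff.1 hjk with h' | h'
    · exact h.ne_spoke _ _ h'.2
    · exact h.ne_spoke _ _ h'.1
  have hsub : edgesIn G X ∪ (E₁ ∪ E₂) ⊆ edgesIn G (X ∪ P.image l) := by
    refine Finset.union_subset (fun e he => ?_) (Finset.union_subset ?_ ?_)
    · induction e with | _ u v
      obtain ⟨⟨hu, hv⟩, huv⟩ := mk_mem_edgesIn.1 he
      exact mk_mem_edgesIn.2 ⟨⟨hXC hu, hXC hv⟩, huv⟩
    · intro e he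
      obtain ⟨j, hj, rfl⟩ := Finset.mem_image.1 he
      exact mk_mem_edgesIn.2 ⟨⟨hlC j, hXC (hcX j)⟩, h.adj_spoke j⟩
    · intro e he
      obtain ⟨j, hj, rfl⟩ := Finset.mem_image.1 he
      exact mk_mem_edgesIn.2 ⟨⟨hlC j, hlC _⟩, h.adj_next j⟩
  have hle := Finset.card_le_card hsub
  rw [Finset.card_union_of_disjoint hd₁, Finset.card_union_of_disjoint hd₂, hE₁, hE₂] at hle
  simp only [predim, hcard] at hlt
  push_cast at hlt
  omega

section LabelExt

variable {α ι : Type*} (G₀ : SimpleGraph α) (s t : ι → α)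

theorem isLabel_labelExt (i : ι) : IsLabel (labelExt G₀ s t) (.inl none) (.inl (some (s i)))
    (.inl (some (t i))) (fun j => .inr (i, j)) := by
  have key : (![.inl none, .inl (some (s i)), .inl (some (t i)), .inl (some (s i))] :
      Fin 4 → Option α ⊕ ι × Fin 4) = fun j => .inl (spoke s t i j) := by
    funext j
    fin_cases j <;> rfl
  refine ⟨fun j k h => by simpa using h, fun j k => ?_, fun j => ⟨rfl, Or.inl rfl⟩, fun j => ?_⟩
  · rw [key]
    exact Sum.inr_ne_inl
  · rw [key]
    exact rfl

/-- The only labels at the labelling vertex whose parameters are old vertices are those attached on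
purpose. -/
theorem exists_of_isLabel_labelExt {a b : α} {l : Fin 4 → Option α ⊕ ι × Fin 4}
    (h : IsLabel (labelExt G₀ s t) (.inl none) (.inl (some a)) (.inl (some b)) l) :
    ∃ i, s i = a ∧ t i = b := by
  have hx : ∀ j, l j ≠ .inl none := fun j => h.ne_spoke j 0
  have ha : ∀ j, l j ≠ .inl (some a) := fun j => h.ne_spoke j 1
  have spoke_eq_none : ∀ i j, none = spoke s t i j → j = 0 := by
    intro i j hj
    fin_cases j
    · rfl
    all_goals exact absurd hj (Option.some_ne_none _).symm
  have h0 := h.adj_spoke 0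
  have h1 := h.adj_spoke 1
  have h2 := h.adj_spoke 2
  have h01 := h.adj_next 0
  have h12 := h.adj_next 1
  have h30 := h.adj_next 3
  change (labelExt G₀ s t).Adj (l 0) (.inl none) at h0
  change (labelExt G₀ s t).Adj (l 1) (.inl (some a)) at h1
  change (labelExt G₀ s t).Adj (l 2) (.inl (some b)) at h2
  change (labelExt G₀ s t).Adj (l 0) (l 1) at h01
  change (labelExt G₀ s t).Adj (l 1) (l 2) at h12
  have h02 : l 0 ≠ l 2 := fun e => absurd (h.injective e) (by decide)
  -- The neighbours of the labelling vertex are the vertices `(i, 0)`.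
  obtain ⟨i, e0⟩ : ∃ i, l 0 = .inr (i, 0) := by
    rcases e : l 0 with u | ⟨i, j⟩
    · rw [e] at h0
      obtain ⟨_, _, _, _, h⟩ := (SimpleGraph.map_adj _ _ _ _).1 h0
      exact absurd h (Option.some_ne_none _)
    · rw [e] at h0
      have := spoke_eq_none i j h0
      exact ⟨i, by rw [this]⟩
  -- Apart from the labelling vertex, the neighbours of `(i, 0)` are `(i, 1)` and `(i, 3)`.
  obtain ⟨j, hj, e1⟩ : ∃ j, (j = 1 ∨ j = 3) ∧ l 1 = .inr (i, j) := by
    rcases e : l 1 with u | ⟨i', j⟩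
    · rw [e0, e] at h01
      have : u = none := h01
      exact absurd (e.trans (congrArg _ this)) (hx 1)
    · rw [e0, e] at h01
      obtain ⟨rfl, hj⟩ : i = i' ∧ (j = 0 + 1 ∨ 0 = j + 1) := h01
      have : ∀ j : Fin 4, j = 0 + 1 ∨ 0 = j + 1 → j = 1 ∨ j = 3 := by decide
      exact ⟨j, this j hj, rfl⟩
  have hsp : spoke s t i j = some (s i) := by rcases hj with rfl | rfl <;> rfl
  have hsa : s i = a := by
    rw [e1] at h1
    have : some a = spoke s t i j := h1
    rw [hsp] at this
    exact (Option.some_injective _ this).symm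
  obtain e2 : l 2 = .inr (i, 2) := by
    rcases e : l 2 with u | ⟨i', k⟩
    · rw [e1, e] at h12
      have : u = spoke s t i j := h12
      rw [hsp, hsa] at this
      exact absurd (e.trans (congrArg _ this)) (ha 2)
    · rw [e1, e] at h12
      obtain ⟨rfl, hk⟩ : i = i' ∧ (k = j + 1 ∨ j = k + 1) := h12
      have hk0 : k ≠ 0 := by
        rintro rfl
        exact h02 (e0.trans e.symm)
      have : ∀ j k : Fin 4, (j = 1 ∨ j = 3) → (k = j + 1 ∨ j = k + 1) → k ≠ 0 → k = 2 := by decide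
      rw [this j k hj hk hk0]
  rw [e2] at h2
  have : some b = some (t i) := h2
  exact ⟨i, hsa, (Option.some_injective _ this).symm⟩

end LabelExt

/-- Over a finite set of parameters every `2`-orientation is encoded by a vertex of `M`. -/
theorem IsFraisseLimit.exists_encoding_vertex {F : ℝ → ℝ} (hF : IsEncodingControl F)
    (hG : IsFraisseLimit F G) {τ : Set (V × V)} (hτ : IsTwoOrientation G τ) (X : Finset V) :
    ∃ x, x ∉ X ∧ ∀ a ∈ X, ∀ b ∈ X, (a, b) ∈ τ ↔ ∃ l, IsLabel G x a b l := by
  classical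
  obtain ⟨A, hXA, hA, hACF⟩ := hG.exists_dClosedIn_superset X
  let α := (A : Set V)
  let ι := {p : α × α // ((p.1 : V), (p.2 : V)) ∈ τ}
  let s : ι → α := fun i => i.1.1
  let t : ι → α := fun i => i.1.2
  have hne : ∀ i, s i ≠ t i := fun i h => (hτ.adj _ _ i.2).ne (congrArg Subtype.val h)
  have hout : ∀ a, (Finset.univ.filter fun i => s i = a).card ≤ 2 := by
    intro a
    have h1 : (Finset.univ.filter fun i => s i = a).card =
        ((Finset.univ.filter fun i => s i = a).image fun i => (t i : V)).card := by
      refine (Finset.card_image_of_injOn fun i hi k hk h => ?_).symm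
      have hi' : s i = a := by simpa using hi
      have hk' : s k = a := by simpa using hk
      exact Subtype.ext (Prod.ext (hi'.trans hk'.symm) (Subtype.ext h))
    have h2 := hτ.outDegree_le (a : V)
    rw [h1]
    refine ENat.natCast_le_natCast.1 (le_trans ?_ h2)
    rw [← Set.encard_coe_eq_coe_finsetCard]
    refine Set.encard_le_encard fun v hv => ?_
    obtain ⟨i, hi, rfl⟩ := Finset.mem_image.1 (Finset.mem_coe.1 hv)
    have hi : s i = a := (Finset.mem_filter.1 hi).2
    have := i.2
    rw [← hi]
    exact this
  let G₀ := G.induce (A : Set V)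
  have hG₀ : InCF G₀ F Finset.univ := by
    refine InCF.of_map (SimpleGraph.Embedding.induce (A : Set V)) (hACF.mono fun v hv => ?_)
    obtain ⟨a, -, rfl⟩ := Finset.mem_map.1 hv
    exact a.2
  obtain ⟨e, heD, hea⟩ := hG.extension (inCF_labelExt G₀ s t hF hne hout hG₀) hA
    (baseEmb G₀ s t) (J := Finset.univ.map (baseEmb G₀ s t).toEmbedding) (fun w => by simp)
    (dClosed_base G₀ s t)
  have hmem : ∀ w, e w ∈ Finset.univ.map e.toEmbedding := fun w =>
    Finset.mem_map_of_mem _ (Finset.mem_univ _)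
  refine ⟨e (.inl none), fun hx => ?_, fun a ha b hb => ⟨fun hab => ?_, ?_⟩⟩
  · have h1 := e.injective (hea ⟨_, hXA hx⟩)
    exact absurd (Sum.inl_injective h1) (Option.some_ne_none _)
  · let i : ι := ⟨(⟨a, hXA ha⟩, ⟨b, hXA hb⟩), hab⟩
    have := (isLabel_labelExt G₀ s t i).map e
    have h1 : e (.inl (some (s i))) = a := hea _
    have h2 : e (.inl (some (t i))) = b := hea _
    rw [h1, h2] at this
    exact ⟨_, this⟩
  · rintro ⟨l, hl⟩
    have h1 : e (.inl (some ⟨a, hXA ha⟩)) = a := hea ⟨a, hXA ha⟩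
    have h2 : e (.inl (some ⟨b, hXA hb⟩)) = b := hea ⟨b, hXA hb⟩
    have hlD := hl.mem_of_dClosedIn heD (hmem _) (h1 ▸ hmem _) (h2 ▸ hmem _)
    choose l' hl' using fun j => Finset.mem_map.1 (hlD j)
    obtain rfl : l = e ∘ l' := funext fun j => (hl' j).2.symm
    rw [← h1, ← h2] at hl
    obtain ⟨i, hi, hi'⟩ := exists_of_isLabel_labelExt G₀ s t (hl.of_map e)
    have := i.2
    change ((s i : V), (t i : V)) ∈ τ at this
    rw [hi, hi'] at this
    exact this

end LabelConfig

/-! ### Types and the decoding map -/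

section Types

variable {V : Type*} {G : SimpleGraph V}

/-- The existence of a label, with the conjunctions nested as in `labelBody`. -/
theorem exists_isLabel_iff {x a b : V} : (∃ l, IsLabel G x a b l) ↔ ∃ l₀ l₁ l₂ l₃ : V,
    (((((((l₀ ≠ l₁ ∧ l₀ ≠ l₂) ∧ l₀ ≠ l₃) ∧ l₁ ≠ l₂) ∧ l₁ ≠ l₃) ∧ l₂ ≠ l₃) ∧
      ((((l₀ ≠ x ∧ l₀ ≠ a) ∧ l₀ ≠ b) ∧ ((l₁ ≠ x ∧ l₁ ≠ a) ∧ l₁ ≠ b)) ∧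
        ((l₂ ≠ x ∧ l₂ ≠ a) ∧ l₂ ≠ b)) ∧ ((l₃ ≠ x ∧ l₃ ≠ a) ∧ l₃ ≠ b)) ∧
      ((((((G.Adj x l₀ ∧ G.Adj l₀ l₁) ∧ G.Adj l₁ l₂) ∧ G.Adj l₂ l₃) ∧ G.Adj l₃ l₀) ∧
        G.Adj l₁ a) ∧ G.Adj l₃ a) ∧ G.Adj l₂ b) := by
  constructor
  · rintro ⟨l, hinj, hne, hn, hs⟩
    have hd : ∀ j k : Fin 4, j ≠ k → l j ≠ l k := fun j k h => hinj.ne h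
    refine ⟨l 0, l 1, l 2, l 3, ⟨⟨⟨⟨⟨⟨hd _ _ ?_, hd _ _ ?_⟩, hd _ _ ?_⟩, hd _ _ ?_⟩, hd _ _ ?_⟩,
      hd _ _ ?_⟩, ⟨⟨⟨⟨hne 0 0, hne 0 1⟩, hne 0 2⟩, ⟨hne 1 0, hne 1 1⟩, hne 1 2⟩,
      ⟨hne 2 0, hne 2 1⟩, hne 2 2⟩, ⟨hne 3 0, hne 3 1⟩, hne 3 2⟩,
      ⟨⟨⟨⟨⟨⟨(hs 0).symm, hn 0⟩, hn 1⟩, hn 2⟩, hn 3⟩, hs 1⟩, hs 3⟩, hs 2⟩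
    all_goals decide
  · rintro ⟨l₀, l₁, l₂, l₃, ⟨⟨⟨⟨⟨⟨h01, h02⟩, h03⟩, h12⟩, h13⟩, h23⟩,
      ⟨⟨⟨⟨h0x, h0a⟩, h0b⟩, ⟨h1x, h1a⟩, h1b⟩, ⟨h2x, h2a⟩, h2b⟩, ⟨h3x, h3a⟩, h3b⟩,
      ⟨⟨⟨⟨⟨⟨g0, g01⟩, g12⟩, g23⟩, g30⟩, g1⟩, g3⟩, g2⟩
    refine ⟨![l₀, l₁, l₂, l₃], ?_, ?_, ?_, ?_⟩
    · intro j k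
      fin_cases j <;> fin_cases k <;> simp_all [eq_comm]
    · simp [Fin.forall_fin_succ, *]
    · intro j
      fin_cases j
      exacts [g01, g12, g23, g30]
    · intro j
      fin_cases j
      exacts [g0.symm, g1, g2, g3]

theorem realize_labelFormula (a b : V) (v : Fin 1 → V) :
    letI := G.structure
    (labelFormula a b).Realize v ↔
      (v 0 ≠ a ∧ v 0 ≠ b ∧ a ≠ b ∧ G.Adj a b) ∧ ∃ l, IsLabel G (v 0) a b l := by
  let := G.structure
  rw [exists_isLabel_iff]
  simp only [labelFormula, labelBody, Language.Formula.Realize,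
    Language.BoundedFormula.realize_inf, Language.BoundedFormula.realize_ex,
    Language.BoundedFormula.realize_not, Language.BoundedFormula.realize_bdEqual,
    Language.BoundedFormula.realize_rel₂, Language.Term.realize_var]
  exact and_congr (by rw [and_assoc, and_assoc]; exact Iff.rfl) Iff.rfl

variable (G) in
/-- The type over `M` of a vertex `x` of `M`. -/
noncomputable def vertexType (x : V) : TypeSpace G :=
  letI := G.structure
  haveI : Nonempty V := ⟨x⟩
  (diagram G).typeOf fun _ => x

theorem contains_vertexType {x a b : V} : Contains (vertexType G x) (labelFormula a b) ↔
    (x ≠ a ∧ x ≠ b ∧ a ≠ b ∧ G.Adj a b) ∧ ∃ l, IsLabel G x a b l := by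
  let := G.structure
  have : Nonempty V := ⟨x⟩
  exact Language.Theory.CompleteType.formula_mem_typeOf.trans (realize_labelFormula a b fun _ => x)

theorem decode_eq_true {p : TypeSpace G} {a b : V} :
    decode p (a, b) = true ↔ Contains p (labelFormula a b) := by
  simp [decode]

theorem encodes_of_decode_eq {p : TypeSpace G} {τ : V × V → Bool} (h : decode p = τ) :
    Encodes p τ := by
  subst h
  refine ⟨fun a b => decode_eq_true.1, fun a b hab => ?_⟩
  rw [decode_eq_true] at hab
  exact (Language.Theory.CompleteType.not_mem_iff p _).2 hab

theorem continuous_decode : Continuous (decode : TypeSpace G → (V × V → Bool)) := by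
  refine continuous_pi fun ab => (continuous_bool_rng true).2 ?_
  have : (fun p : TypeSpace G => decode p ab) ⁻¹' {true} =
      (diagram G).typesWith (Language.Formula.equivSentence (labelFormula ab.1 ab.2)) := by
    ext p
    exact decode_eq_true
  rw [this]
  exact CompleteType.isClopen_typesWith _

theorem translate_labelFormula (g : V → V) (a b : V) :
    (translate g).onSentence (Language.Formula.equivSentence (labelFormula a b)) =
      Language.Formula.equivSentence (labelFormula (g a) (g b)) := by
  unfold labelFormula labelBody
  change Language.BoundedFormula.imp _ _ = Language.BoundedFormula.imp _ _
  -- The two formulas differ only in how the argument tuples of their symbols are presented.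
  repeat' first
    | exact i.elim0
    | refine congrArg₂ Language.BoundedFormula.imp ?_ ?_
    | refine congrArg Language.BoundedFormula.all ?_
    | refine congrArg₂ Language.BoundedFormula.equal ?_ ?_
    | refine congrArg (Language.BoundedFormula.rel _)
        (funext (Fin.forall_fin_two.2 ⟨?_, ?_⟩))
    | refine congrArg (Language.Term.func _) (funext fun i : Fin 0 => i.elim0)
    | rfl

theorem decode_smul (g : G ≃g G) (p : TypeSpace G) : decode (g • p) = g • decode p := by
  funext ⟨a, b⟩
  rw [Bool.eq_iff_iff]
  change _ ↔ decode p (g⁻¹ a, g⁻¹ b) = true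
  rw [decode_eq_true, decode_eq_true, Contains, Contains,
    ← translate_labelFormula (g⁻¹ : G ≃g G) a b]
  exact Iff.rfl

/-- By compactness of the type space the range of `decode` is closed, and the types of vertices of
`M` decode to points arbitrarily close to a given `2`-orientation. -/
theorem IsFraisseLimit.orientations_subset_range_decode {F : ℝ → ℝ} (hF : IsEncodingControl F)
    (hG : IsFraisseLimit F G) :
    orientations G ⊆ Set.range (decode : TypeSpace G → (V × V → Bool)) := by
  classical
  intro τ hτ
  rw [← (isCompact_range continuous_decode).isClosed.closure_eq, mem_closure_iff]
  intro U hU hτU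
  obtain ⟨I, u, hu, hIU⟩ := isOpen_pi_iff.1 hU τ hτU
  obtain ⟨x, hx, hxl⟩ := hG.exists_encoding_vertex hF hτ (I.image Prod.fst ∪ I.image Prod.snd)
  refine ⟨decode (vertexType G x), hIU ?_, vertexType G x, rfl⟩
  rintro ⟨a, b⟩ hab
  have ha : a ∈ I.image Prod.fst ∪ I.image Prod.snd :=
    Finset.mem_union_left _ (Finset.mem_image_of_mem Prod.fst (Finset.mem_coe.1 hab))
  have hb : b ∈ I.image Prod.fst ∪ I.image Prod.snd :=
    Finset.mem_union_right _ (Finset.mem_image_of_mem Prod.snd (Finset.mem_coe.1 hab))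
  have h : decode (vertexType G x) (a, b) = τ (a, b) := by
    rw [Bool.eq_iff_iff, decode_eq_true, contains_vertexType]
    refine Iff.trans ?_ (hxl a ha b hb).symm
    refine and_iff_right_of_imp fun hl => ?_
    have hadj := hτ.adj _ _ ((hxl a ha b hb).2 hl)
    exact ⟨fun e => hx (e ▸ ha), fun e => hx (e ▸ hb), hadj.ne, hadj⟩
  rw [h]
  exact (hu _ hab).2

end Types

/-! ### The flow of 2-orientations -/

section Orientations

variable {V : Type*} {G : SimpleGraph V}

theorem encard_le_two_iff {α : Type*} {s : Set α} : s.encard ≤ 2 ↔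
    ∀ x y z, x ∈ s → y ∈ s → z ∈ s → x = y ∨ x = z ∨ y = z := by
  classical
  constructor
  · intro h x y z hx hy hz
    by_contra! hne
    have h3 : ({x, y, z} : Set α).encard = 3 :=
      Set.encard_eq_three.2 ⟨x, y, z, hne.1, hne.2.1, hne.2.2, rfl⟩
    have h4 : ({x, y, z} : Set α) ⊆ s := by
      rintro w (rfl | rfl | rfl) <;> assumption
    have := (Set.encard_le_encard h4).trans h
    rw [h3] at this
    exact absurd this (by decide)
  · intro h
    by_contra! h2
    obtain ⟨t, hts, ht⟩ := Set.exists_subset_encard_eq (Order.add_one_le_of_lt h2)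
    obtain ⟨x, y, z, hxy, hxz, hyz, rfl⟩ := Set.encard_eq_three.1 (ht.trans (by norm_num))
    rcases h x y z (hts (by simp)) (hts (by simp)) (hts (by simp)) with e | e | e
    exacts [hxy e, hxz e, hyz e]

theorem isClosed_orientations : IsClosed (orientations G) := by
  have key : ∀ (p q r : V × V) (s : Set (Bool × Bool × Bool)),
      IsClosed {χ : V × V → Bool | (χ p, χ q, χ r) ∈ s} := fun p q r s =>
    (isClosed_discrete s).preimage (f := fun χ : V × V → Bool => (χ p, χ q, χ r)) (by fun_prop)
  have h : orientations G =
      (⋂ x, ⋂ y, {χ | (χ (x, y), χ (y, x), χ (x, y)) ∈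
        {c : Bool × Bool × Bool | (c.1 = true → G.Adj x y) ∧
          (G.Adj x y → Xor (c.1 = true) (c.2.1 = true))}}) ∩
      ⋂ x, ⋂ y₁, ⋂ y₂, ⋂ y₃, {χ | (χ (x, y₁), χ (x, y₂), χ (x, y₃)) ∈
        {c : Bool × Bool × Bool | c.1 = true → c.2.1 = true → c.2.2 = true →
          y₁ = y₂ ∨ y₁ = y₃ ∨ y₂ = y₃}} := by
    ext χ
    simp only [Set.mem_inter_iff, Set.mem_iInter]
    constructor
    · intro hχ
      exact ⟨fun x y => ⟨hχ.adj x y, hχ.exactly_one x y⟩,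
        fun x => encard_le_two_iff.1 (hχ.outDegree_le x)⟩
    · rintro ⟨h1, h2⟩
      exact ⟨fun x y => (h1 x y).1, fun x y => (h1 x y).2, fun x => encard_le_two_iff.2 (h2 x)⟩
  rw [h]
  refine IsClosed.inter ?_ ?_
  · exact isClosed_iInter fun x => isClosed_iInter fun y => key _ _ _ _
  · exact isClosed_iInter fun x => isClosed_iInter fun y₁ => isClosed_iInter fun y₂ =>
      isClosed_iInter fun y₃ => key _ _ _ _

theorem smul_mem_orientations (g : G ≃g G) {χ : V × V → Bool} (hχ : χ ∈ orientations G) :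
    g • χ ∈ orientations G := by
  have hadj : ∀ x y, G.Adj (g⁻¹ x) (g⁻¹ y) ↔ G.Adj x y := fun x y => (g⁻¹ : G ≃g G).map_rel_iff
  refine ⟨fun x y h => (hadj x y).1 (hχ.adj _ _ h),
    fun x y h => hχ.exactly_one _ _ ((hadj x y).2 h), fun x => encard_le_two_iff.2 ?_⟩
  intro y₁ y₂ y₃ h₁ h₂ h₃
  have h := encard_le_two_iff.1 (hχ.outDegree_le (g⁻¹ x)) _ _ _ h₁ h₂ h₃
  simpa only [(g⁻¹ : G ≃g G).injective.eq_iff] using h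

theorem IsFraisseLimit.card_edgesIn_le {F : ℝ → ℝ} (hF : IsControl F) (hG : IsFraisseLimit F G)
    (X : Finset V) : (edgesIn G X).card ≤ 2 * X.card := by
  obtain ⟨A, hXA, -, hA⟩ := hG.exists_dClosedIn_superset X
  have h1 := hA.2 X hXA
  have h2 := hF.mono_nat (Nat.zero_le X.card)
  rw [Nat.cast_zero, hF.map_zero] at h2
  have h3 : 0 ≤ predim G X := by exact_mod_cast h2.trans h1
  rw [predim] at h3
  omega

/-- A `2`-orientation exists by Hall's theorem: every edge has to choose one of two slots at one of
its ends, and a finite set `X` of vertices spans at most `2 |X|` edges. -/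
theorem IsFraisseLimit.orientations_nonempty {F : ℝ → ℝ} (hF : IsControl F)
    (hG : IsFraisseLimit F G) : (orientations G).Nonempty := by
  classical
  obtain ⟨f, hinj, hf⟩ := (Finset.all_card_le_biUnion_card_iff_exists_injective
    fun e : G.edgeSet => (e : Sym2 V).toFinset ×ˢ (Finset.univ : Finset (Fin 2))).1 (by
      intro s
      let X : Finset V := s.biUnion fun e => (e : Sym2 V).toFinset
      have h1 : s.biUnion (fun e => (e : Sym2 V).toFinset ×ˢ (Finset.univ : Finset (Fin 2))) =
          X ×ˢ Finset.univ := by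
        ext ⟨v, c⟩
        simp [X]
      have h2 : s.card ≤ (edgesIn G X).card := by
        rw [← Finset.card_map (Function.Embedding.subtype _)]
        refine Finset.card_le_card fun e he => ?_
        obtain ⟨e, hes, rfl⟩ := Finset.mem_map.1 he
        obtain ⟨e, hE⟩ := e
        induction e with | _ x y
        refine mk_mem_edgesIn.2 ⟨⟨?_, ?_⟩, hE⟩
        · exact Finset.mem_biUnion.2 ⟨_, hes, by simp⟩
        · exact Finset.mem_biUnion.2 ⟨_, hes, by simp⟩
      have h3 := hG.card_edgesIn_le hF X
      rw [h1, Finset.card_product, Finset.card_univ, Fintype.card_fin]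
      omega)
  let ρ : Set (V × V) := {p | ∃ h : G.Adj p.1 p.2, (f ⟨s(p.1, p.2), h⟩).1 = p.1}
  have hmem : ∀ x y (h : G.Adj x y), (f ⟨s(x, y), h⟩).1 = x ∨ (f ⟨s(x, y), h⟩).1 = y := by
    intro x y h
    simpa using (Finset.mem_product.1 (hf ⟨s(x, y), h⟩)).1
  have hswap : ∀ x y (h : G.Adj x y), f ⟨s(y, x), h.symm⟩ = f ⟨s(x, y), h⟩ := fun x y h =>
    congrArg f (Subtype.ext Sym2.eq_swap)
  have hρ : IsTwoOrientation G ρ := by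
    refine ⟨fun x y h => h.1, fun x y h => ?_, fun x => encard_le_two_iff.2 ?_⟩
    · rcases hmem x y h with hx | hy
      · refine Or.inl ⟨⟨h, hx⟩, fun ⟨h', hy⟩ => h.ne ?_⟩
        exact hx.symm.trans ((congrArg Prod.fst (hswap x y h)).symm.trans hy)
      · refine Or.inr ⟨⟨h.symm, (congrArg Prod.fst (hswap x y h)).trans hy⟩, fun ⟨h', hx⟩ => ?_⟩
        exact h.ne (hx.symm.trans hy)
    · rintro y₁ y₂ y₃ ⟨h₁, e₁⟩ ⟨h₂, e₂⟩ ⟨h₃, e₃⟩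
      have key : ∀ y z (hy : G.Adj x y) (hz : G.Adj x z), (f ⟨s(x, y), hy⟩).1 = x →
          (f ⟨s(x, z), hz⟩).1 = x → (f ⟨s(x, y), hy⟩).2 = (f ⟨s(x, z), hz⟩).2 → y = z := by
        intro y z hy hz ey ez h
        exact Sym2.congr_right.1 (congrArg Subtype.val (hinj (Prod.ext (ey.trans ez.symm) h)))
      have pigeon : ∀ a b c : Fin 2, a = b ∨ a = c ∨ b = c := by decide
      rcases pigeon (f ⟨s(x, y₁), h₁⟩).2 (f ⟨s(x, y₂), h₂⟩).2 (f ⟨s(x, y₃), h₃⟩).2 with h | h | h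
      · exact Or.inl (key _ _ h₁ h₂ e₁ e₂ h)
      · exact Or.inr (Or.inl (key _ _ h₁ h₃ e₁ e₃ h))
      · exact Or.inr (Or.inr (key _ _ h₂ h₃ e₂ e₃ h))
  refine ⟨fun p => decide (p ∈ ρ), ?_⟩
  change IsTwoOrientation G {p | decide (p ∈ ρ) = true}
  simpa only [decide_eq_true_eq, Set.ofPred_mem_eq] using hρ

end Orientations

end Encoding

open Encoding in
theorem lemma5p3 (F : ℝ → ℝ) (hF : IsEncodingControl F)
    {V : Type*} (G : SimpleGraph V) (hG : IsFraisseLimit F G) :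
    (∀ τ ∈ orientations G, ∃ p : TypeSpace G, Encodes p τ) ∧
    (Continuous (decode : TypeSpace G → (V × V → Bool)) ∧
      ∀ (g : G ≃g G) (p : TypeSpace G), decode (g • p) = g • decode p) ∧
    IsSubflow (G ≃g G) (Set.range (decode : TypeSpace G → (V × V → Bool))) ∧
    IsSubflow (G ≃g G) (orientations G) ∧
    orientations G ⊆ Set.range (decode : TypeSpace G → (V × V → Bool)) := by
  have hsub := hG.orientations_subset_range_decode hF
  have hne := hG.orientations_nonempty hF.toIsControl
  refine ⟨fun τ hτ => ?_, ⟨continuous_decode, decode_smul⟩,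
    ⟨hne.mono hsub, isCompact_range continuous_decode, ?_⟩,
    ⟨hne, isClosed_orientations.isCompact, fun g χ hχ => smul_mem_orientations g hχ⟩, hsub⟩
  · obtain ⟨p, hp⟩ := hsub hτ
    exact ⟨p, encodes_of_decode_eq hp⟩
  · rintro g _ ⟨p, rfl⟩
    exact ⟨g • p, decode_smul g p⟩
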